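/- Setting. Let $\mathcal X$ be a Borel subset of $\mathbb R^d$, $\mu$ a probability measure on $\mathcal X$, and let $f,f_1,\dots,f_M:\mathcal X\to\mathbb R$ be measurable with $|f|\le L$ and $|f_j|\le L$ on $\mathcal X$. One observes $Y_i=f(X_i)+W_i$, $i=1,\dots,n$, where $X_1,\dots,X_n$ are i.i.d. with law $\mu$ and the errors $W_1,\dots,W_n$ are i.i.d. $N(0,\sigma^2)$, $\sigma>0$, independent of $(X_1,\dots,X_n)$. Write $\|g\|^2=\int g^2\,d\mu$. For $\lambda\in\mathbb R^M$ let ${\sf f}_\lambda=\sum_{j=1}^M\lambda_jf_j$, let $M(\lambda)$ be the number of non-zero coordinates of $\lambda$, and for $K_1>0$ put $$\widehat S(\lambda)=\frac1n\sum_{i=1}^n\{Y_i-{\sf f}_\lambda(X_i)\}^2,\qquad \mathrm{pen}(\lambda)=K_1\frac{M(\lambda)}{n}\log\Bigl(1+\frac{M\vee n}{M(\lambda)\vee1}\Bigr).$$ For $T\ge1$ let $\widetilde f={\sf f}_{\widehat\lambda}$, where $\widehat\lambda$ is any measurable minimizer of $\widehat S(\lambda)+\mathrm{pen}(\lambda)$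 over $\{\lambda\in\mathbb R^M:\sum_{j=1}^M|\lambda_j|\le T\}$, and set $B=L^2(T+1)^2$. Corollary 3.7 [MS]. There is a threshold $K^*=K^*(\varepsilon,B,\sigma^2)>0$, depending on nothing else, such that for every $R\ge1$ there is a constant $c>0$, depending only on $R$, with the following property. For all $\varepsilon>0$, $\sigma>0$, $T\ge1$ and $L$, for every $K_1$ that is large enough and of the order of the threshold, namely $K^*(\varepsilon,B,\sigma^2)\le K_1\le R\,K^*(\varepsilon,B,\sigma^2)$, for all integers $n\ge1$, $M\ge2$, $d\ge 0$ and all $\mathcal X,\mu,f,f_1,\dots,f_M$ as above, $$\mathbb E\,\|\widetilde f-f\|^2\le(1+\varepsilon)\min_{1\le j\le M}\|f_j-f\|^2+C\,\sigma^2\Bigl(1+\frac1\varepsilon\Bigr)\frac{\log(M\vee n)}{n},\qquad C=c\Bigl(1+\frac{B}{\sigma^2}\Bigr),$$ where $\|\widetilde f-f\|^2$ is integrable. -/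

import Mathlib

open MeasureTheory ProbabilityTheory

noncomputable section

namespace Aggregation

/-- The linear combination `f_lam = ∑ j, lam j * f_j` of the functions `f_1, …, f_M`. -/
def linComb {S : Type*} {M : ℕ} (fs : Fin M → S → ℝ) (lam : Fin M → ℝ) (x : S) : ℝ :=
  ∑ j, lam j * fs j x

/-- `M(lam)`: the number of non-zero coordinates of `lam`. -/
def numNonzero {M : ℕ} (lam : Fin M → ℝ) : ℕ :=
  (Finset.univ.filter fun j => lam j ≠ 0).card

/-- The `ℓ¹`-ball `Λ_{M,T}`. -/
def l1Ball (M : ℕ) (T : ℝ) : Set (Fin M → ℝ) :=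
  {lam | ∑ j, |lam j| ≤ T}

/-- The residual sum of squares `n⁻¹ ∑ i, (Y_i - f_lam(X_i))²` of the sample
`(x_1, y_1), …, (x_n, y_n)`. -/
def residual {S : Type*} {n M : ℕ} (fs : Fin M → S → ℝ) (x : Fin n → S) (y : Fin n → ℝ)
    (lam : Fin M → ℝ) : ℝ :=
  (1 / (n : ℝ)) * ∑ i, (y i - linComb fs lam (x i)) ^ 2

/-- The hard threshold penalty for random design,
`K₁ (M(lam) / n) log (1 + (M ∨ n) / (M(lam) ∨ 1))`. -/
def penalty (K₁ : ℝ) (n : ℕ) {M : ℕ} (lam : Fin M → ℝ) : ℝ :=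
  K₁ * ((numNonzero lam : ℝ) / (n : ℝ)) *
    Real.log (1 + max (M : ℝ) (n : ℝ) / max (numNonzero lam : ℝ) 1)

/-- `lam` is a penalized least squares estimate: it minimizes `residual + penalty` over the
`ℓ¹`-ball of radius `T`. -/
def IsPenalizedLSE {S : Type*} {n M : ℕ} (K₁ T : ℝ) (fs : Fin M → S → ℝ)
    (x : Fin n → S) (y : Fin n → ℝ) (lam : Fin M → ℝ) : Prop :=
  lam ∈ l1Ball M T ∧
    ∀ lam' ∈ l1Ball M T,
      residual fs x y lam + penalty K₁ n lam ≤ residual fs x y lam' + penalty K₁ n lam'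

/-- The squared `L²(μ)` norm `‖g‖² = ∫ g² dμ`. -/
def l2NormSq {S : Type*} [MeasurableSpace S] (μ : Measure S) (g : S → ℝ) : ℝ :=
  ∫ x, g x ^ 2 ∂μ

/-- Gaussian regression with random design: the design points `X_i` are i.i.d. with law `μ`, the
errors `W_i` are i.i.d. `N(0, σ²)`, and the errors are independent of the design. -/
structure IsGaussianRandomDesign {Ω S : Type*} [MeasurableSpace Ω] [MeasurableSpace S] {n : ℕ}
    (P : Measure Ω) (μ : Measure S) (σ : ℝ) (X : Fin n → Ω → S) (W : Fin n → Ω → ℝ) : Prop where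
  measurable_design : ∀ i, Measurable (X i)
  law_design : ∀ i, P.map (X i) = μ
  indep_design : iIndepFun X P
  measurable_error : ∀ i, Measurable (W i)
  law_error : ∀ i, P.map (W i) = gaussianReal 0 (Real.toNNReal (σ ^ 2))
  indep_error : iIndepFun W P
  indep_design_error : IndepFun (fun ω i => X i ω) (fun ω i => W i ω) P

end Aggregation

end

/-!
For a function `g` bounded by `b`, the deviation `‖g‖² - (1 + ε) n⁻¹ ∑ i, (g(X_i)² - 2 W_i g(X_i))`
has exponential moment at most `1` at the parameter `n t` with `t = ε / (16 (σ² + b²))`: the term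
`ε g²` pays for the quadratic term of the expansion and for the Gaussian noise. Hence the expected
excess of a deviation over `q` is at most `exp (-n t q) / (n t)`.

Apply this to `g = f_lam - f` for all `lam` in the grid `(T / n) ℤ^M ∩ Λ_{M,T}`. The grid has so few
points with `s` non-zero coordinates that half of the penalty, taken as `q`, makes these bounds sum
to `2 / (n t)`. Truncating the coordinates of an arbitrary `lam` in the ball to multiples of `T / n`
creates no new non-zero coordinate and moves `lam` by at most `T (M(lam) / n ∧ 1)` in `ℓ¹`, which
costs at most the other half of the penalty, up to the excess of `n⁻¹ ∑ i, W_i²` over `2 σ²`, whose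
mean is of order `σ² / n`. So the penalty dominates the deviation of the estimate, and comparing the
estimate with the vertices `lam = e_j`, for `ε ∧ 1` in place of `ε`, gives the result.
-/

noncomputable section

namespace Aggregation

section ExponentialMoments

variable {Ω : Type*} [MeasurableSpace Ω] {P : Measure Ω}

lemma max_zero_le_exp_mul_div {s : ℝ} (hs : 0 < s) (x : ℝ) :
    max x 0 ≤ Real.exp (s * x) / s := by
  rw [le_div_iff₀ hs, max_mul_of_nonneg _ _ hs.le, zero_mul, mul_comm]
  exact max_le (by linarith [Real.add_one_le_exp (s * x)]) (Real.exp_pos _).le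

lemma integral_max_sub_zero_le_mgf [IsFiniteMeasure P] {Z : Ω → ℝ} {s : ℝ} (hs : 0 < s)
    (hZ : Integrable (fun ω => Real.exp (s * Z ω)) P) (q : ℝ) :
    Integrable (fun ω => max (Z ω - q) 0) P ∧
      ∫ ω, max (Z ω - q) 0 ∂P ≤ Real.exp (-(s * q)) / s * mgf Z P s := by
  have hle : ∀ ω, max (Z ω - q) 0 ≤ Real.exp (-(s * q)) / s * Real.exp (s * Z ω) := fun ω =>
    (max_zero_le_exp_mul_div hs _).trans_eq <| by
      rw [div_mul_eq_mul_div, ← Real.exp_add]; ring_nf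
  have hmeas : AEMeasurable Z P :=
    Real.aemeasurable_of_aemeasurable_exp_mul hs.ne' hZ.aemeasurable
  have hint : Integrable (fun ω => max (Z ω - q) 0) P :=
    (hZ.const_mul _).mono' ((hmeas.sub_const q).max aemeasurable_const).aestronglyMeasurable <|
      ae_of_all _ fun ω => by
        rw [Real.norm_of_nonneg (le_max_right _ _)]
        exact hle ω
  refine ⟨hint, ?_⟩
  rw [mgf, ← integral_const_mul]
  exact integral_mono hint (hZ.const_mul _) hle

lemma integral_max_mean_sub_zero_le [IsProbabilityMeasure P] {n : ℕ} (hn : 1 ≤ n)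
    {Z : Fin n → Ω → ℝ} (hindep : iIndepFun Z P) (hmeas : ∀ i, Measurable (Z i)) {t a : ℝ}
    (ht : 0 < t) (hint : ∀ i, Integrable (fun ω => Real.exp (t * Z i ω)) P)
    (hmgf : ∀ i, mgf (Z i) P t ≤ Real.exp a) (q : ℝ) :
    Integrable (fun ω => max ((1 / (n : ℝ)) * ∑ i, Z i ω - q) 0) P ∧
      ∫ ω, max ((1 / (n : ℝ)) * ∑ i, Z i ω - q) 0 ∂P
        ≤ Real.exp (n * (a - t * q)) / (n * t) := by
  have hn₀ : (0 : ℝ) < n := by exact_mod_cast hn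
  have hmean : ∀ ω, n * t * ((1 / (n : ℝ)) * ∑ i, Z i ω) = t * (∑ i, Z i) ω := fun ω => by
    rw [Finset.sum_apply]; field_simp
  obtain ⟨hexcess, hle⟩ := integral_max_sub_zero_le_mgf (mul_pos hn₀ ht)
    (Z := fun ω => (1 / (n : ℝ)) * ∑ i, Z i ω)
    (by simpa only [hmean] using hindep.integrable_exp_mul_sum hmeas fun i _ => hint i) q
  refine ⟨hexcess, hle.trans ?_⟩
  have hmgf_mean : mgf (fun ω => (1 / (n : ℝ)) * ∑ i, Z i ω) P (n * t) ≤ Real.exp (n * a) :=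
    calc mgf (fun ω => (1 / (n : ℝ)) * ∑ i, Z i ω) P (n * t)
        = ∏ i, mgf (Z i) P t := by
          rw [← hindep.mgf_sum hmeas Finset.univ]; simp only [mgf, hmean]
      _ ≤ ∏ _i : Fin n, Real.exp a := Finset.prod_le_prod (fun _ _ => mgf_nonneg) fun i _ => hmgf i
      _ = Real.exp (n * a) := by simp [← Real.exp_nat_mul]
  calc Real.exp (-(n * t * q)) / (n * t) * mgf (fun ω => (1 / (n : ℝ)) * ∑ i, Z i ω) P (n * t)
      ≤ Real.exp (-(n * t * q)) / (n * t) * Real.exp (n * a) := by gcongr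
    _ = Real.exp (n * (a - t * q)) / (n * t) := by
        rw [div_mul_eq_mul_div, ← Real.exp_add]; ring_nf

end ExponentialMoments

section Gaussian

variable {v : NNReal}

lemma integral_exp_add_mul_gaussianReal (v : NNReal) (a c : ℝ) :
    ∫ w, Real.exp (a + c * w) ∂gaussianReal 0 v = Real.exp (a + v * c ^ 2 / 2) := by
  have h := congrFun (mgf_fun_id_gaussianReal (μ := 0) (v := v)) c
  simp only [mgf, zero_mul, zero_add] at h
  simp only [Real.exp_add, integral_const_mul, h]

lemma mgf_sq_gaussianReal (hv : v ≠ 0) {s : ℝ} (hs : 2 * s * v < 1) :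
    mgf (fun w => w ^ 2) (gaussianReal 0 v) s = (√(1 - 2 * s * v))⁻¹ := by
  have : (0 : ℝ) < v := by positivity
  have : 0 < 1 - 2 * s * v := by linarith
  have hpdf : ∀ w : ℝ, gaussianPDFReal 0 v w * Real.exp (s * w ^ 2)
      = (√(2 * Real.pi * v))⁻¹ * Real.exp (-((1 - 2 * s * v) / (2 * v)) * w ^ 2) := fun w => by
    rw [gaussianPDFReal, mul_assoc, ← Real.exp_add]
    congr 2
    field_simp
    ring
  simp only [mgf, integral_gaussianReal_eq_integral_smul hv, smul_eq_mul, hpdf,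
    integral_const_mul, integral_gaussian]
  rw [← Real.sqrt_inv, ← Real.sqrt_inv, ← Real.sqrt_mul (by positivity)]
  congr 1
  field_simp

variable {S : Type*} [MeasurableSpace S] {μ : Measure S} [SFinite μ]

lemma integral_exp_add_mul_prod_gaussianReal {α β : S → ℝ} (hα : Measurable α) (hβ : Measurable β)
    (hint : Integrable (fun x => Real.exp (α x + v * β x ^ 2 / 2)) μ) :
    Integrable (fun p : S × ℝ => Real.exp (α p.1 + β p.1 * p.2)) (μ.prod (gaussianReal 0 v)) ∧
      ∫ p, Real.exp (α p.1 + β p.1 * p.2) ∂μ.prod (gaussianReal 0 v)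
        = ∫ x, Real.exp (α x + v * β x ^ 2 / 2) ∂μ := by
  have hprod : Integrable (fun p : S × ℝ => Real.exp (α p.1 + β p.1 * p.2))
      (μ.prod (gaussianReal 0 v)) := by
    refine (integrable_prod_iff (by fun_prop)).2 ⟨ae_of_all _ fun x => ?_, ?_⟩
    · simpa only [Real.exp_add] using (integrable_exp_mul_gaussianReal (β x)).const_mul _
    · simpa only [Real.norm_of_nonneg (Real.exp_pos _).le, integral_exp_add_mul_gaussianReal]
        using hint
  refine ⟨hprod, ?_⟩
  simp only [integral_prod _ hprod, integral_exp_add_mul_gaussianReal]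

end Gaussian

section Design

variable {Ω S : Type*} [MeasurableSpace Ω] [MeasurableSpace S] {P : Measure Ω}

lemma iIndepFun_prodMk [IsProbabilityMeasure P] {ι E : Type*} [Finite ι] [MeasurableSpace E]
    {X : ι → Ω → S} {W : ι → Ω → E} (hX : ∀ i, Measurable (X i)) (hW : ∀ i, Measurable (W i))
    (hX_indep : iIndepFun X P) (hW_indep : iIndepFun W P)
    (hXW : IndepFun (fun ω i => X i ω) (fun ω i => W i ω) P) :
    iIndepFun (fun i ω => (X i ω, W i ω)) P := by
  have := Fintype.ofFinite ι
  have := fun i => Measure.isProbabilityMeasure_map (μ := P) (hX i).aemeasurable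
  have := fun i => Measure.isProbabilityMeasure_map (μ := P) (hW i).aemeasurable
  have hpair : ∀ i, P.map (fun ω => (X i ω, W i ω)) = (P.map (X i)).prod (P.map (W i)) := fun i =>
    (indepFun_iff_map_prod_eq_prod_map_map (hX i).aemeasurable (hW i).aemeasurable).1
      (hXW.comp (measurable_pi_apply i) (measurable_pi_apply i))
  have hjoint : P.map (fun ω => ((fun i => X i ω), fun i => W i ω))
      = (Measure.pi fun i => P.map (X i)).prod (Measure.pi fun i => P.map (W i)) := by
    rw [(indepFun_iff_map_prod_eq_prod_map_map (by fun_prop) (by fun_prop)).1 hXW,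
      hX_indep.map_fun_eq_pi_map fun i => (hX i).aemeasurable,
      hW_indep.map_fun_eq_pi_map fun i => (hW i).aemeasurable]
  rw [iIndepFun_iff_map_fun_eq_pi_map fun i => ((hX i).prodMk (hW i)).aemeasurable]
  simp only [hpair]
  rw [← (measurePreserving_arrowProdEquivProdArrow S E ι _ _).symm.map_eq, ← hjoint,
    Measure.map_map (MeasurableEquiv.measurable _) (by fun_prop)]
  rfl

namespace IsGaussianRandomDesign

variable {n : ℕ} {μ : Measure S} {σ : ℝ} {X : Fin n → Ω → S} {W : Fin n → Ω → ℝ}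

lemma measurable_observation (h : IsGaussianRandomDesign P μ σ X W) (i : Fin n) :
    Measurable fun ω => (X i ω, W i ω) :=
  (h.measurable_design i).prodMk (h.measurable_error i)

lemma iIndepFun_observation [IsProbabilityMeasure P] (h : IsGaussianRandomDesign P μ σ X W) :
    iIndepFun (fun i ω => (X i ω, W i ω)) P :=
  iIndepFun_prodMk h.measurable_design h.measurable_error h.indep_design h.indep_error
    h.indep_design_error

lemma map_observation [IsProbabilityMeasure P] (h : IsGaussianRandomDesign P μ σ X W) (i : Fin n) :
    P.map (fun ω => (X i ω, W i ω)) = μ.prod (gaussianReal 0 (Real.toNNReal (σ ^ 2))) := by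
  rw [(indepFun_iff_map_prod_eq_prod_map_map (h.measurable_design i).aemeasurable
    (h.measurable_error i).aemeasurable).1
      (h.indep_design_error.comp (measurable_pi_apply i) (measurable_pi_apply i)),
    h.law_design i, h.law_error i]

end IsGaussianRandomDesign

end Design

section L2Norm

variable {S : Type*} [MeasurableSpace S] {μ : Measure S} {g : S → ℝ} {b : ℝ}

lemma l2NormSq_nonneg (μ : Measure S) (g : S → ℝ) : 0 ≤ l2NormSq μ g :=
  integral_nonneg fun _ => sq_nonneg _

lemma integrable_sq_of_abs_le [IsFiniteMeasure μ] (hg : Measurable g) (hb : ∀ x, |g x| ≤ b) :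
    Integrable (fun x => g x ^ 2) μ :=
  .of_bound (hg.pow_const 2).aestronglyMeasurable (b ^ 2) <| ae_of_all _ fun x => by
    rw [Real.norm_eq_abs, abs_pow]
    exact pow_le_pow_left₀ (abs_nonneg _) (hb x) 2

end L2Norm

section Contrast

variable {S : Type*} {n : ℕ}

/-- The empirical excess risk `n⁻¹ ∑ i, (g(x_i)² - 2 w_i g(x_i))` of a regression function whose
error is `g`, at the design points `x_i` and for the errors `w_i`. Its mean is `‖g‖²`. -/
def contrast (g : S → ℝ) (x : Fin n → S) (w : Fin n → ℝ) : ℝ :=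
  (1 / (n : ℝ)) * ∑ i, (g (x i) ^ 2 - 2 * w i * g (x i))

/-- The mean square of the errors. -/
def meanSq (w : Fin n → ℝ) : ℝ := (1 / (n : ℝ)) * ∑ i, w i ^ 2

/-- The excess of the squared `L²` norm of `g` over `1 + ε` times its empirical version. -/
def deviation [MeasurableSpace S] (μ : Measure S) (ε : ℝ) (g : S → ℝ) (x : Fin n → S)
    (w : Fin n → ℝ) : ℝ :=
  l2NormSq μ g - (1 + ε) * contrast g x w

lemma residual_eq {M : ℕ} (fs : Fin M → S → ℝ) (f : S → ℝ) (x : Fin n → S) (w : Fin n → ℝ)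
    (lam : Fin M → ℝ) :
    residual fs x (fun i => f (x i) + w i) lam
      = meanSq w + contrast (fun z => linComb fs lam z - f z) x w := by
  rw [residual, meanSq, contrast, ← mul_add, ← Finset.sum_add_distrib]
  congr 2
  ext i
  ring

end Contrast

section DeviationBounds

lemma exp_neg_mul_add_le_one_sub {ε t u v : ℝ} (hε₁ : ε ≤ 1) (ht : 0 ≤ t)
    (hu : 0 ≤ u) (hv : 0 ≤ v) (hts : t * (16 * (v + u)) ≤ ε) :
    Real.exp (-(t * (1 + ε) * u) + v * (2 * t * (1 + ε)) ^ 2 * u / 2) ≤ 1 - t * u := by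
  have htu : 0 ≤ t * u := mul_nonneg ht hu
  have htv : 0 ≤ t * v := mul_nonneg ht hv
  have hε : 0 ≤ ε := by linarith
  have htu_le : t * u ≤ ε / 16 := by linarith
  have htv_le : t * v ≤ ε / 16 := by linarith
  have hfactor : ∀ τ ≤ ε / 16, ∀ δ ≤ ε, 0 ≤ τ → 0 ≤ δ → τ * (1 + δ) ^ 2 ≤ ε / 4 :=
    fun τ hτ δ hδ _ hδ₀ => calc
      τ * (1 + δ) ^ 2 ≤ ε / 16 * (1 + 1) ^ 2 := by gcongr; exact hδ.trans hε₁
      _ = ε / 4 := by ring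
  obtain ⟨y, hy⟩ : ∃ y, y = t * u * (1 + ε / 2) := ⟨_, rfl⟩
  have hy₁ : |(-y)| ≤ 1 := by
    rw [abs_neg, hy, abs_of_nonneg (by positivity)]
    nlinarith
  have hexponent : -(t * (1 + ε) * u) + v * (2 * t * (1 + ε)) ^ 2 * u / 2 ≤ -y := by
    have := hfactor (t * v) htv_le ε le_rfl htv hε
    linarith [mul_le_mul_of_nonneg_left this htu]
  have hsq : y ^ 2 ≤ t * u * (ε / 2) := by
    have := hfactor (t * u) htu_le (ε / 2) (by linarith) htu (by positivity)
    rw [hy]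
    nlinarith
  calc Real.exp (-(t * (1 + ε) * u) + v * (2 * t * (1 + ε)) ^ 2 * u / 2)
      ≤ Real.exp (-y) := Real.exp_le_exp.2 hexponent
    _ ≤ 1 - y + y ^ 2 := by linarith [(abs_le.1 (Real.abs_exp_sub_one_sub_id_le hy₁)).2]
    _ ≤ 1 - t * u := by linarith

variable {S : Type*} [MeasurableSpace S] {μ : Measure S}

lemma mgf_deviation_le_one [IsProbabilityMeasure μ] {g : S → ℝ} (hg : Measurable g) {b : ℝ}
    (hb : ∀ x, |g x| ≤ b) {v : NNReal} {ε t : ℝ} (hε₁ : ε ≤ 1) (ht : 0 ≤ t)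
    (hts : t * (16 * (v + b ^ 2)) ≤ ε) :
    Integrable (fun p : S × ℝ =>
        Real.exp (t * (l2NormSq μ g - (1 + ε) * (g p.1 ^ 2 - 2 * p.2 * g p.1))))
        (μ.prod (gaussianReal 0 v)) ∧
      mgf (fun p : S × ℝ => l2NormSq μ g - (1 + ε) * (g p.1 ^ 2 - 2 * p.2 * g p.1))
        (μ.prod (gaussianReal 0 v)) t ≤ 1 := by
  set G := l2NormSq μ g
  have hexponent : ∀ p : S × ℝ, t * (G - (1 + ε) * (g p.1 ^ 2 - 2 * p.2 * g p.1))
      = t * (G - (1 + ε) * g p.1 ^ 2) + 2 * t * (1 + ε) * g p.1 * p.2 := fun p => by ring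
  have hsq : Integrable (fun x => g x ^ 2) μ := integrable_sq_of_abs_le hg hb
  have hbound : Integrable (fun x => Real.exp (t * G) * (1 - t * g x ^ 2)) μ :=
    ((integrable_const 1).sub (hsq.const_mul t)).const_mul _
  have hle : ∀ x, Real.exp (t * (G - (1 + ε) * g x ^ 2) + v * (2 * t * (1 + ε) * g x) ^ 2 / 2)
      ≤ Real.exp (t * G) * (1 - t * g x ^ 2) := fun x => by
    have hgb : g x ^ 2 ≤ b ^ 2 := sq_le_sq.2 ((hb x).trans (le_abs_self b))
    have := exp_neg_mul_add_le_one_sub hε₁ ht (sq_nonneg (g x)) v.2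
      (le_trans (by gcongr; exact le_rfl) hts)
    calc Real.exp (t * (G - (1 + ε) * g x ^ 2) + v * (2 * t * (1 + ε) * g x) ^ 2 / 2)
        = Real.exp (t * G)
            * Real.exp (-(t * (1 + ε) * g x ^ 2) + v * (2 * t * (1 + ε)) ^ 2 * g x ^ 2 / 2) := by
          rw [← Real.exp_add]; ring_nf
      _ ≤ Real.exp (t * G) * (1 - t * g x ^ 2) := by gcongr; exact this
  have hint : Integrable (fun x =>
      Real.exp (t * (G - (1 + ε) * g x ^ 2) + v * (2 * t * (1 + ε) * g x) ^ 2 / 2)) μ :=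
    hbound.mono' (by fun_prop) <| ae_of_all _ fun x => by
      simpa only [Real.norm_of_nonneg (Real.exp_pos _).le] using hle x
  obtain ⟨hprod, heq⟩ := integral_exp_add_mul_prod_gaussianReal (by fun_prop) (by fun_prop) hint
  simp only [mgf, hexponent]
  refine ⟨hprod, heq.trans_le ?_⟩
  calc ∫ x, Real.exp (t * (G - (1 + ε) * g x ^ 2) + v * (2 * t * (1 + ε) * g x) ^ 2 / 2) ∂μ
      ≤ ∫ x, Real.exp (t * G) * (1 - t * g x ^ 2) ∂μ := integral_mono hint hbound hle
    _ = Real.exp (t * G) * (1 - t * G) := by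
        rw [integral_const_mul, integral_sub (integrable_const 1) (hsq.const_mul t),
          integral_const_mul]
        simp [G, l2NormSq]
    _ ≤ Real.exp (t * G) * Real.exp (-(t * G)) := by
        gcongr; exact Real.one_sub_le_exp_neg _
    _ = 1 := by rw [← Real.exp_add, add_neg_cancel, Real.exp_zero]

lemma integral_sq_sub_prod_gaussianReal [IsProbabilityMeasure μ] (v : NNReal) {g : S → ℝ}
    (hg : Measurable g) {b : ℝ} (hb : ∀ x, |g x| ≤ b) :
    Integrable (fun p : S × ℝ => g p.1 ^ 2 - 2 * p.2 * g p.1) (μ.prod (gaussianReal 0 v)) ∧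
      ∫ p : S × ℝ, (g p.1 ^ 2 - 2 * p.2 * g p.1) ∂μ.prod (gaussianReal 0 v) = l2NormSq μ g := by
  have hgint : Integrable g μ := .of_bound hg.aestronglyMeasurable b (ae_of_all _ hb)
  have hid : Integrable (fun w : ℝ => w) (gaussianReal 0 v) :=
    (memLp_id_gaussianReal 1).integrable le_rfl
  have hsq := (integrable_sq_of_abs_le (μ := μ) hg hb).comp_fst (gaussianReal 0 v)
  have hcross : Integrable (fun p : S × ℝ => 2 * (g p.1 * p.2)) (μ.prod (gaussianReal 0 v)) :=
    (hgint.mul_prod hid).const_mul 2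
  have hterm : ∀ p : S × ℝ, g p.1 ^ 2 - 2 * p.2 * g p.1 = g p.1 ^ 2 - 2 * (g p.1 * p.2) :=
    fun p => by ring
  simp only [hterm]
  refine ⟨hsq.sub hcross, ?_⟩
  rw [integral_sub hsq hcross, integral_const_mul, integral_prod_mul g fun w => w,
    integral_id_gaussianReal, mul_zero, mul_zero, sub_zero, integral_fun_fst fun x => g x ^ 2]
  simp [l2NormSq]

namespace IsGaussianRandomDesign

variable {Ω : Type*} [MeasurableSpace Ω] {P : Measure Ω} [IsProbabilityMeasure P] {n : ℕ} {σ : ℝ}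
  {X : Fin n → Ω → S} {W : Fin n → Ω → ℝ}

lemma integral_contrast [IsProbabilityMeasure μ] (h : IsGaussianRandomDesign P μ σ X W)
    (hn : 1 ≤ n) {g : S → ℝ} (hg : Measurable g) {b : ℝ} (hb : ∀ x, |g x| ≤ b) :
    Integrable (fun ω => contrast g (fun i => X i ω) (fun i => W i ω)) P ∧
      ∫ ω, contrast g (fun i => X i ω) (fun i => W i ω) ∂P = l2NormSq μ g := by
  have hterm : ∀ i, Integrable (fun ω => g (X i ω) ^ 2 - 2 * W i ω * g (X i ω)) P ∧
      ∫ ω, (g (X i ω) ^ 2 - 2 * W i ω * g (X i ω)) ∂P = l2NormSq μ g := fun i => by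
    obtain ⟨hint, heq⟩ := integral_sq_sub_prod_gaussianReal (μ := μ) (Real.toNNReal (σ ^ 2)) hg hb
    rw [← h.map_observation i] at hint heq
    have hobs := h.measurable_observation i
    exact ⟨hint.comp_measurable hobs,
      (integral_map hobs.aemeasurable hint.aestronglyMeasurable).symm.trans heq⟩
  refine ⟨(integrable_finsetSum _ fun i _ => (hterm i).1).const_mul _, ?_⟩
  simp only [contrast]
  rw [integral_const_mul, integral_finsetSum _ fun i _ => (hterm i).1]
  simp only [(hterm _).2, Finset.sum_const, Finset.card_univ, Fintype.card_fin, nsmul_eq_mul]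
  field_simp

lemma integral_deviation_excess_le [IsProbabilityMeasure μ]
    (h : IsGaussianRandomDesign P μ σ X W) (hn : 1 ≤ n) {g : S → ℝ} (hg : Measurable g) {b : ℝ}
    (hb : ∀ x, |g x| ≤ b) {ε t : ℝ} (hε₁ : ε ≤ 1) (ht : 0 < t)
    (hts : t * (16 * (σ ^ 2 + b ^ 2)) ≤ ε) (q : ℝ) :
    Integrable (fun ω => max (deviation μ ε g (fun i => X i ω) (fun i => W i ω) - q) 0) P ∧
      ∫ ω, max (deviation μ ε g (fun i => X i ω) (fun i => W i ω) - q) 0 ∂P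
        ≤ Real.exp (-(n * t * q)) / (n * t) := by
  obtain ⟨hint, hmgf⟩ := mgf_deviation_le_one (μ := μ) hg hb (v := Real.toNNReal (σ ^ 2)) hε₁
    ht.le (by rwa [Real.coe_toNNReal _ (sq_nonneg σ)])
  set Z : S × ℝ → ℝ := fun p => l2NormSq μ g - (1 + ε) * (g p.1 ^ 2 - 2 * p.2 * g p.1)
  have hZ : Measurable Z := by fun_prop
  have hdev : ∀ ω, deviation μ ε g (fun i => X i ω) (fun i => W i ω)
      = (1 / (n : ℝ)) * ∑ i, Z (X i ω, W i ω) := fun ω => by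
    simp only [Z, deviation, contrast, Finset.sum_sub_distrib, ← Finset.mul_sum, Finset.sum_const,
      Finset.card_univ, Fintype.card_fin, nsmul_eq_mul]
    field_simp
  have hexcess := integral_max_mean_sub_zero_le hn
    (h.iIndepFun_observation.comp (fun _ => Z) fun _ => hZ)
    (fun i => hZ.comp (h.measurable_observation i)) ht (a := 0)
    (fun i => by
      rw [← h.map_observation i] at hint
      exact hint.comp_measurable (h.measurable_observation i))
    (fun i => by
      rwa [← mgf_map (h.measurable_observation i).aemeasurable (by fun_prop), h.map_observation i,
        Real.exp_zero]) q
  simpa only [hdev, Function.comp_apply, zero_sub, mul_neg, ← mul_assoc] using hexcess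

lemma integral_meanSq_excess_le (h : IsGaussianRandomDesign P μ σ X W) (hn : 1 ≤ n)
    (hσ : 0 < σ) :
    Integrable (fun ω => max (meanSq (fun i => W i ω) - 2 * σ ^ 2) 0) P ∧
      ∫ ω, max (meanSq (fun i => W i ω) - 2 * σ ^ 2) 0 ∂P ≤ 4 * σ ^ 2 / n := by
  set v := Real.toNNReal (σ ^ 2)
  have hv : (v : ℝ) = σ ^ 2 := Real.coe_toNNReal _ (sq_nonneg σ)
  have hmgf : ∀ i, mgf (fun ω => W i ω ^ 2) P (1 / (4 * σ ^ 2)) = √2 := fun i => by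
    have hmap := mgf_map (μ := P) (X := fun w : ℝ => w ^ 2) (t := 1 / (4 * σ ^ 2))
      (h.measurable_error i).aemeasurable (by fun_prop)
    rw [← Function.comp_def (fun w : ℝ => w ^ 2) (W i), ← hmap, h.law_error i,
      mgf_sq_gaussianReal (by simpa [v] using hσ.ne') (by rw [hv]; field_simp; norm_num),
      hv, ← Real.sqrt_inv]
    congr 1
    field_simp
    norm_num
  have hsqrt : √2 ≤ Real.exp (1 / 2) := by
    rw [Real.sqrt_le_left (Real.exp_pos _).le, ← Real.exp_nat_mul]
    norm_num
    linarith [Real.add_one_le_exp 1]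
  obtain ⟨hint, hle⟩ := integral_max_mean_sub_zero_le hn
    (h.indep_error.comp (fun _ w => w ^ 2) fun _ => by fun_prop)
    (fun i => (h.measurable_error i).pow_const 2) (t := 1 / (4 * σ ^ 2)) (by positivity)
    (fun i => mgf_pos_iff.1 ((hmgf i).symm ▸ by positivity))
    (fun i => (hmgf i).trans_le hsqrt) (2 * σ ^ 2)
  refine ⟨hint, hle.trans_eq ?_⟩
  rw [show (1 / 2 : ℝ) - 1 / (4 * σ ^ 2) * (2 * σ ^ 2) = 0 by field_simp; norm_num, mul_zero,
    Real.exp_zero]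
  field_simp

end IsGaussianRandomDesign

end DeviationBounds

section Complexity

/-- The complexity `k log (1 + m / (k ∨ 1))` of a model of dimension `k`, so that the penalty of
`lam` is `(K₁ / n) * complexity (M ∨ n) M(lam)`. -/
def complexity (m : ℝ) (k : ℕ) : ℝ := k * Real.log (1 + m / max (k : ℝ) 1)

lemma penalty_eq (K₁ : ℝ) (n : ℕ) {M : ℕ} (lam : Fin M → ℝ) :
    penalty K₁ n lam = K₁ / n * complexity (max (M : ℝ) n) (numNonzero lam) := by
  rw [penalty, complexity]
  ring

lemma complexity_zero (m : ℝ) : complexity m 0 = 0 := by simp [complexity]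

lemma complexity_of_pos (m : ℝ) {k : ℕ} (hk : 1 ≤ k) :
    complexity m k = k * Real.log (1 + m / k) := by
  rw [complexity, max_eq_left (by exact_mod_cast hk)]

lemma complexity_nonneg {m : ℝ} (hm : 0 ≤ m) (k : ℕ) : 0 ≤ complexity m k :=
  mul_nonneg k.cast_nonneg (Real.log_nonneg (le_add_of_nonneg_right (by positivity)))

lemma complexity_mono {m : ℝ} (hm : 0 ≤ m) : Monotone (complexity m) := by
  intro s k hsk
  rcases Nat.eq_zero_or_pos s with rfl | hs
  · rw [complexity_zero]; exact complexity_nonneg hm k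
  have hs₀ : (0 : ℝ) < s := by exact_mod_cast hs
  have hk₀ : (0 : ℝ) < k := by exact_mod_cast hs.trans_le hsk
  have bernoulli : 1 + m / s ≤ (1 + m / k) ^ ((k : ℝ) / s) := by
    have h := one_add_mul_self_le_rpow_one_add (s := m / k) (by linarith [div_nonneg hm hk₀.le])
      (p := k / s) ((one_le_div hs₀).2 (by exact_mod_cast hsk))
    rwa [show (k : ℝ) / s * (m / k) = m / s by field_simp] at h
  rw [complexity_of_pos m hs, complexity_of_pos m (hs.trans_le hsk)]
  calc (s : ℝ) * Real.log (1 + m / s)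
      ≤ s * Real.log ((1 + m / k) ^ ((k : ℝ) / s)) := by gcongr
    _ = k * Real.log (1 + m / k) := by rw [Real.log_rpow (by positivity)]; field_simp

lemma mul_log_two_le_complexity {m : ℝ} {k : ℕ} (hk : (k : ℝ) ≤ m) :
    k * Real.log 2 ≤ complexity m k := by
  rcases Nat.eq_zero_or_pos k with rfl | hk₁
  · simp [complexity]
  have hk₀ : (0 : ℝ) < k := by exact_mod_cast hk₁
  have : 1 ≤ m / k := (one_le_div hk₀).2 hk
  rw [complexity_of_pos m hk₁]
  gcongr
  linarith

end Complexity

section Counting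

variable {ι : Type*} [Fintype ι] [DecidableEq ι]

/-- The integer points of the `ℓ¹`-ball of radius `n` in `ℝ^ι`. -/
def intL1Ball (ι : Type*) [Fintype ι] [DecidableEq ι] (n : ℕ) : Finset (ι → ℤ) :=
  {a ∈ Fintype.piFinset fun _ => Finset.Icc (-(n : ℤ)) n | ∑ j, |a j| ≤ n}

lemma mem_intL1Ball {n : ℕ} {a : ι → ℤ} : a ∈ intL1Ball ι n ↔ ∑ j, |(a j : ℝ)| ≤ n := by
  have hcast : ∑ j, |(a j : ℝ)| ≤ n ↔ ∑ j, |a j| ≤ n := by norm_cast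
  simp only [hcast, intL1Ball, Finset.mem_filter, Fintype.mem_piFinset, Finset.mem_Icc,
    and_iff_right_iff_imp]
  exact fun h j => abs_le.1 <|
    (Finset.single_le_sum (f := fun j => |a j|) (fun i _ => abs_nonneg (a i))
      (Finset.mem_univ j)).trans h

lemma sum_range_exp_neg_pow_succ_le {θ : ℝ} (hθ : 0 < θ) (n : ℕ) :
    ∑ k ∈ Finset.range n, Real.exp (-θ) ^ (k + 1) ≤ 1 / θ := by
  have hgeom := geom_sum_mul_neg (Real.exp (-θ)) n
  have hexp : Real.exp (-θ) * (θ + 1) ≤ 1 := by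
    calc Real.exp (-θ) * (θ + 1) ≤ Real.exp (-θ) * Real.exp θ := by
          gcongr; exact Real.add_one_le_exp θ
      _ = 1 := by rw [← Real.exp_add, neg_add_cancel, Real.exp_zero]
  have hsum : 0 ≤ ∑ k ∈ Finset.range n, Real.exp (-θ) ^ k := by positivity
  have hpow : 0 < Real.exp (-θ) ^ n := by positivity
  simp only [pow_succ, ← Finset.sum_mul]
  rw [le_div_iff₀ hθ]
  nlinarith

lemma sum_Icc_exp_neg_mul_abs_le {θ y : ℝ} (hθ : 0 < θ) (hy : 0 ≤ y) (n : ℕ) :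
    ∑ r ∈ Finset.Icc (-(n : ℤ)) n, Real.exp (-(θ * |(r : ℝ)|)) * (if r ≠ 0 then y else 1)
      ≤ 1 + 2 * y / θ := by
  have hpos : ∀ k : ℕ, Real.exp (-(θ * |(((k + 1 : ℕ) : ℤ) : ℝ)|))
      * (if ((k + 1 : ℕ) : ℤ) ≠ 0 then y else 1) = Real.exp (-θ) ^ (k + 1) * y := fun k => by
    rw [if_pos (by positivity), ← Real.exp_nat_mul, Int.cast_natCast, Nat.abs_cast]
    ring_nf
  rw [Finset.sum_Icc_of_even_eq_range (fun r => by simp), Finset.sum_range_succ']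
  simp only [hpos, ← Finset.sum_mul]
  calc _ = 1 + 2 * ((∑ k ∈ Finset.range n, Real.exp (-θ) ^ (k + 1)) * y) := by simp; ring
    _ ≤ 1 + 2 * (1 / θ * y) := by gcongr; exact sum_range_exp_neg_pow_succ_le hθ n
    _ = 1 + 2 * y / θ := by ring

-- A counted point has weight at least `exp (-θ n) * y ^ s` under a product weight whose total mass
-- factors over the coordinates.
lemma card_hammingNorm_eq_mul_le {θ y : ℝ} (hθ : 0 < θ) (hy : 0 ≤ y) (n s : ℕ) :
    ({a ∈ intL1Ball ι n | hammingNorm a = s}.card : ℝ) * (Real.exp (-(θ * n)) * y ^ s)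
      ≤ (1 + 2 * y / θ) ^ Fintype.card ι := by
  let weight (r : ℤ) : ℝ := Real.exp (-(θ * |(r : ℝ)|)) * (if r ≠ 0 then y else 1)
  have hweight : ∀ r, 0 ≤ weight r := fun r => by positivity
  have hprod : ∀ a ∈ {a ∈ intL1Ball ι n | hammingNorm a = s},
      Real.exp (-(θ * n)) * y ^ s ≤ ∏ j, weight (a j) := fun a ha => by
    obtain ⟨hball, hnorm⟩ := Finset.mem_filter.1 ha
    rw [Finset.prod_mul_distrib, ← Real.exp_sum, ← Finset.prod_filter, Finset.prod_const,
      Finset.sum_neg_distrib, ← Finset.mul_sum, ← hnorm, hammingNorm]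
    gcongr
    exact mem_intL1Ball.1 hball
  calc ({a ∈ intL1Ball ι n | hammingNorm a = s}.card : ℝ) * (Real.exp (-(θ * n)) * y ^ s)
      ≤ ∑ a ∈ {a ∈ intL1Ball ι n | hammingNorm a = s}, ∏ j, weight (a j) := by
        simpa only [nsmul_eq_mul] using Finset.card_nsmul_le_sum _ _ _ hprod
    _ ≤ ∑ a ∈ Fintype.piFinset fun _ : ι => Finset.Icc (-(n : ℤ)) n, ∏ j, weight (a j) :=
        Finset.sum_le_sum_of_subset_of_nonneg
          ((Finset.filter_subset _ _).trans (Finset.filter_subset _ _))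
          fun a _ _ => Finset.prod_nonneg fun j _ => hweight (a j)
    _ = (∑ r ∈ Finset.Icc (-(n : ℤ)) n, weight r) ^ Fintype.card ι := by
        rw [← Finset.prod_univ_sum (fun _ : ι => Finset.Icc (-(n : ℤ)) n) fun _ r => weight r,
          Finset.prod_const, Finset.card_univ]
    _ ≤ (1 + 2 * y / θ) ^ Fintype.card ι :=
        pow_le_pow_left₀ (Finset.sum_nonneg fun r _ => hweight r)
          (sum_Icc_exp_neg_mul_abs_le hθ hy n) _

lemma card_hammingNorm_eq_le [Nonempty ι] {n s : ℕ} (hn : 1 ≤ n) (hs : 1 ≤ s) :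
    ({a ∈ intL1Ball ι n | hammingNorm a = s}.card : ℝ)
      ≤ (2 * Real.exp 2 * (n * Fintype.card ι) / (s : ℝ) ^ 2) ^ s := by
  have : (0 : ℝ) < n := by exact_mod_cast hn
  have : (0 : ℝ) < s := by exact_mod_cast hs
  have : (0 : ℝ) < Fintype.card ι := by exact_mod_cast Fintype.card_pos
  have h := card_hammingNorm_eq_mul_le (ι := ι) (θ := s / n)
    (y := s ^ 2 / (2 * (n * Fintype.card ι))) (by positivity) (by positivity) n s
  have hbase : (1 + 2 * ((s : ℝ) ^ 2 / (2 * (n * Fintype.card ι))) / (s / n)) ^ Fintype.card ι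
      ≤ Real.exp s :=
    calc (1 + 2 * ((s : ℝ) ^ 2 / (2 * (n * Fintype.card ι))) / (s / n)) ^ Fintype.card ι
        = (s / Fintype.card ι + 1 : ℝ) ^ Fintype.card ι := by congr 1; field_simp; ring
      _ ≤ Real.exp (s / Fintype.card ι) ^ Fintype.card ι := by
          gcongr; exact Real.add_one_le_exp _
      _ = Real.exp s := by rw [← Real.exp_nat_mul]; congr 1; field_simp
  have hexp : Real.exp 2 ^ s * Real.exp (-(s / n * n)) = Real.exp s := by
    rw [← Real.exp_nat_mul, ← Real.exp_add]; congr 1; field_simp; ring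
  refine le_of_mul_le_mul_right ((h.trans hbase).trans_eq ?_) (by positivity)
  rw [← hexp, show 2 * Real.exp 2 * (n * Fintype.card ι) / (s : ℝ) ^ 2
    = Real.exp 2 / (s ^ 2 / (2 * (n * Fintype.card ι))) by field_simp, div_pow]
  field_simp

lemma exp_neg_complexity_le {n M s : ℕ} {m : ℝ} (hnm : n ≤ m) (hMm : M ≤ m)
    (hs : 1 ≤ s) (hsm : s ≤ m) :
    2 * Real.exp 2 * (n * M) / (s : ℝ) ^ 2 * Real.exp (-(7 * Real.log (1 + m / s))) ≤ 1 / 2 := by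
  have hs₀ : (0 : ℝ) < s := by exact_mod_cast hs
  have hm₀ : 0 ≤ m := hs₀.le.trans hsm
  set u : ℝ := m / s
  have hu : 1 ≤ u := (one_le_div hs₀).2 hsm
  have hexp_two : Real.exp 2 ≤ 8 := by
    rw [show (2 : ℝ) = 1 + 1 by norm_num, Real.exp_add]
    nlinarith [Real.exp_one_lt_d9, Real.exp_pos 1]
  have hexp_log : Real.exp (-(7 * Real.log (1 + u))) = ((1 + u) ^ 7)⁻¹ := by
    rw [Real.exp_neg, show (7 : ℝ) = (7 : ℕ) by norm_num, ← Real.log_pow,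
      Real.exp_log (by positivity)]
  rw [hexp_log, ← div_eq_mul_inv, div_le_iff₀ (by positivity)]
  calc 2 * Real.exp 2 * (n * M) / (s : ℝ) ^ 2 ≤ 2 * 8 * (m * m) / (s : ℝ) ^ 2 := by gcongr
    _ = 1 / 2 * (1 + 1) ^ 5 * u ^ 2 := by simp only [u]; ring
    _ ≤ 1 / 2 * (1 + u) ^ 5 * (1 + u) ^ 2 := by gcongr; linarith
    _ = 1 / 2 * (1 + u) ^ 7 := by ring

lemma sum_hammingNorm_eq_exp_neg_complexity_le [Nonempty ι] {n : ℕ} (hn : 1 ≤ n) {m : ℝ}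
    (hnm : n ≤ m) (hm : Fintype.card ι ≤ m) {s : ℕ} (hsm : s ≤ m) :
    ∑ a ∈ intL1Ball ι n with hammingNorm a = s, Real.exp (-(7 * complexity m (hammingNorm a)))
      ≤ (1 / 2) ^ s := by
  rw [Finset.sum_congr rfl fun a ha => by rw [(Finset.mem_filter.1 ha).2], Finset.sum_const,
    nsmul_eq_mul]
  rcases Nat.eq_zero_or_pos s with rfl | hs
  · have : {a ∈ intL1Ball ι n | hammingNorm a = 0}.card ≤ 1 :=
      Finset.card_le_one.2 fun a ha b hb =>
        (hammingNorm_eq_zero.1 (Finset.mem_filter.1 ha).2).trans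
          (hammingNorm_eq_zero.1 (Finset.mem_filter.1 hb).2).symm
    simpa [complexity_zero] using this
  calc ({a ∈ intL1Ball ι n | hammingNorm a = s}.card : ℝ) * Real.exp (-(7 * complexity m s))
      ≤ (2 * Real.exp 2 * (n * Fintype.card ι) / (s : ℝ) ^ 2) ^ s
          * Real.exp (-(7 * Real.log (1 + m / s))) ^ s := by
        rw [← Real.exp_nat_mul, complexity_of_pos m hs, mul_neg, mul_left_comm]
        gcongr
        exact card_hammingNorm_eq_le hn hs
    _ ≤ (1 / 2) ^ s := by
        rw [← mul_pow]
        exact pow_le_pow_left₀ (by positivity) (exp_neg_complexity_le hnm hm hs hsm) s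

lemma sum_exp_neg_complexity_le_two [Nonempty ι] {n : ℕ} (hn : 1 ≤ n) {m : ℝ}
    (hnm : n ≤ m) (hm : Fintype.card ι ≤ m) :
    ∑ a ∈ intL1Ball ι n, Real.exp (-(7 * complexity m (hammingNorm a))) ≤ 2 := by
  rw [← Finset.sum_fiberwise_of_maps_to (t := Finset.range (Fintype.card ι + 1)) (g := hammingNorm)
    fun a _ => Finset.mem_range.2 (Nat.lt_succ_of_le hammingNorm_le_card_fintype)]
  refine (Finset.sum_le_sum fun s hs => ?_).trans (sum_geometric_two_le (Fintype.card ι + 1))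
  have hsι : (s : ℝ) ≤ Fintype.card ι := by
    exact_mod_cast Nat.lt_succ_iff.1 (Finset.mem_range.1 hs)
  exact sum_hammingNorm_eq_exp_neg_complexity_le hn hnm hm (hsι.trans hm)

end Counting

section LinComb

variable {S : Type*} {M : ℕ}

lemma measurable_linComb [MeasurableSpace S] {fs : Fin M → S → ℝ} (hfs : ∀ j, Measurable (fs j)) :
    Measurable fun p : (Fin M → ℝ) × S => linComb fs p.1 p.2 := by
  unfold linComb
  fun_prop

lemma measurable_linComb_sub [MeasurableSpace S] {f : S → ℝ} {fs : Fin M → S → ℝ}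
    (hf : Measurable f) (hfs : ∀ j, Measurable (fs j)) (lam : Fin M → ℝ) :
    Measurable fun x => linComb fs lam x - f x :=
  ((measurable_linComb hfs).comp measurable_prodMk_left).sub hf

lemma abs_linComb_le {fs : Fin M → S → ℝ} {L : ℝ} {x : S} (hfs : ∀ j, |fs j x| ≤ L)
    (lam : Fin M → ℝ) : |linComb fs lam x| ≤ (∑ j, |lam j|) * L := by
  rw [linComb, Finset.sum_mul]
  refine (Finset.abs_sum_le_sum_abs _ _).trans (Finset.sum_le_sum fun j _ => ?_)
  rw [abs_mul]
  exact mul_le_mul_of_nonneg_left (hfs j) (abs_nonneg _)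

lemma abs_linComb_sub_le {f : S → ℝ} {fs : Fin M → S → ℝ} {L T : ℝ} {x : S} (hf : |f x| ≤ L)
    (hfs : ∀ j, |fs j x| ≤ L) {lam : Fin M → ℝ} (hlam : lam ∈ l1Ball M T) :
    |linComb fs lam x - f x| ≤ L * (T + 1) := calc
  |linComb fs lam x - f x| ≤ |linComb fs lam x| + |f x| := abs_sub _ _
  _ ≤ (∑ j, |lam j|) * L + L := add_le_add (abs_linComb_le hfs lam) hf
  _ ≤ T * L + L := by gcongr; exacts [(abs_nonneg _).trans hf, hlam]
  _ = L * (T + 1) := by ring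

lemma linComb_sub_linComb (fs : Fin M → S → ℝ) (lam lam' : Fin M → ℝ) (x : S) :
    linComb fs lam x - linComb fs lam' x = linComb fs (lam - lam') x := by
  simp only [linComb, ← Finset.sum_sub_distrib, Pi.sub_apply, sub_mul]

lemma linComb_single (fs : Fin M → S → ℝ) (j : Fin M) :
    linComb fs (Pi.single j 1) = fs j := by
  ext x
  simp [linComb, Pi.single_apply]

lemma numNonzero_single (j : Fin M) : numNonzero (Pi.single j 1 : Fin M → ℝ) = 1 := by
  rw [numNonzero, Finset.card_eq_one]
  exact ⟨j, by ext i; simp [Pi.single_apply]⟩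

lemma single_mem_l1Ball {T : ℝ} (hT : 1 ≤ T) (j : Fin M) :
    (Pi.single j 1 : Fin M → ℝ) ∈ l1Ball M T := by
  simpa [l1Ball, Pi.single_apply, apply_ite abs] using hT

end LinComb

section Grid

lemma exists_int_abs_le_and_abs_sub_le (r : ℝ) :
    ∃ z : ℤ, |(z : ℝ)| ≤ |r| ∧ |r - z| ≤ min 1 |r| := by
  wlog hr : 0 ≤ r generalizing r
  · obtain ⟨z, hz, hrz⟩ := this (-r) (by linarith)
    refine ⟨-z, by simpa using hz, ?_⟩
    rwa [Int.cast_neg, sub_neg_eq_add, ← abs_neg, neg_add, ← sub_eq_add_neg, ← abs_neg r]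
  have hfloor : (0 : ℝ) ≤ ⌊r⌋ := by exact_mod_cast Int.floor_nonneg.2 hr
  refine ⟨⌊r⌋, ?_, ?_⟩
  · rw [abs_of_nonneg hfloor, abs_of_nonneg hr]
    exact Int.floor_le r
  · rw [Int.self_sub_floor, Int.abs_fract, abs_of_nonneg hr]
    exact le_min (Int.fract_lt_one r).le (by rw [← Int.self_sub_floor]; linarith)

lemma exists_int_abs_sub_mul_le {δ : ℝ} (hδ : 0 < δ) (r : ℝ) :
    ∃ z : ℤ, δ * |(z : ℝ)| ≤ |r| ∧ |r - δ * z| ≤ min δ |r| := by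
  obtain ⟨z, hz, hrz⟩ := exists_int_abs_le_and_abs_sub_le (r / δ)
  have hscale : |r| = δ * |r / δ| := by rw [abs_div, abs_of_pos hδ]; field_simp
  refine ⟨z, hscale ▸ by gcongr, ?_⟩
  calc |r - δ * z| = δ * |r / δ - z| := by
        nth_rw 2 [← abs_of_pos hδ]
        rw [← abs_mul]
        congr 1
        field_simp
    _ ≤ δ * min 1 |r / δ| := by gcongr
    _ = min δ |r| := by rw [mul_min_of_nonneg _ _ hδ.le, mul_one, ← hscale]

variable {M n : ℕ} {T : ℝ}

/-- The point of the `ℓ¹`-ball of radius `T` obtained by rescaling an integer point of the ball of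
radius `n`. -/
def gridPoint (T : ℝ) (n : ℕ) (a : Fin M → ℤ) (j : Fin M) : ℝ := T / n * a j

lemma gridPoint_mem_l1Ball (hn : 1 ≤ n) (hT : 0 ≤ T) {a : Fin M → ℤ}
    (ha : a ∈ intL1Ball (Fin M) n) : gridPoint T n a ∈ l1Ball M T := by
  have : (0 : ℝ) < n := by exact_mod_cast hn
  calc ∑ j, |gridPoint T n a j| = T / n * ∑ j, |(a j : ℝ)| := by
        simp only [gridPoint, abs_mul, abs_of_nonneg (div_nonneg hT n.cast_nonneg),
          ← Finset.mul_sum]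
    _ ≤ T / n * n := by gcongr; exact mem_intL1Ball.1 ha
    _ = T := by field_simp

lemma exists_sum_abs_sub_gridPoint_le (hn : 1 ≤ n) (hT : 0 < T) {lam : Fin M → ℝ}
    (hlam : lam ∈ l1Ball M T) :
    ∃ a ∈ intL1Ball (Fin M) n, hammingNorm a ≤ numNonzero lam ∧
      ∑ j, |lam j - gridPoint T n a j| ≤ T * min ((numNonzero lam : ℝ) / n) 1 := by
  have hδ : 0 < T / n := div_pos hT (by exact_mod_cast hn)
  choose z hz hrz using exists_int_abs_sub_mul_le hδ
  have hz₀ : z 0 = 0 := by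
    have := hz 0
    rw [abs_zero, mul_nonpos_iff_pos_imp_nonpos] at this
    simpa using this.1 hδ
  refine ⟨fun j => z (lam j), mem_intL1Ball.2 ?_, ?_, ?_⟩
  · refine le_of_mul_le_mul_left ?_ hδ
    calc T / n * ∑ j, |(z (lam j) : ℝ)| ≤ ∑ j, |lam j| := by
          rw [Finset.mul_sum]; gcongr with j; exact hz _
      _ ≤ T := hlam
      _ = T / n * n := by field_simp
  · exact hammingNorm_comp_le_hammingNorm (x := lam) (fun _ => z) fun _ => hz₀
  · rw [mul_min_of_nonneg _ _ hT.le, mul_one]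
    refine le_min ?_ ((Finset.sum_le_sum fun j _ => (hrz (lam j)).trans
      (min_le_right _ _)).trans hlam)
    calc ∑ j, |lam j - T / n * z (lam j)|
        ≤ ∑ j, if lam j ≠ 0 then T / n else 0 := by
          gcongr with j
          split_ifs with hj
          · exact (hrz _).trans (min_le_left _ _)
          · simp [not_not.1 hj, hz₀]
      _ = T * (numNonzero lam / n) := by
          rw [← Finset.sum_filter, Finset.sum_const, nsmul_eq_mul, numNonzero]
          ring

end Grid

section Stability

variable {S : Type*} {n : ℕ} {g h : S → ℝ} {b : ℝ}

lemma abs_sq_sub_sq_le {u v δ : ℝ} (hu : |u| ≤ b) (hv : |v| ≤ b) (huv : |u - v| ≤ δ) :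
    |u ^ 2 - v ^ 2| ≤ 2 * b * δ := calc
  |u ^ 2 - v ^ 2| = |u + v| * |u - v| := by rw [← abs_mul]; ring_nf
  _ ≤ (b + b) * δ := by
    have hb : 0 ≤ b := (abs_nonneg u).trans hu
    gcongr
    exact (abs_add_le u v).trans (add_le_add hu hv)
  _ = 2 * b * δ := by ring

lemma meanSq_nonneg (w : Fin n → ℝ) : 0 ≤ meanSq w := by
  unfold meanSq
  positivity

lemma l2NormSq_le [MeasurableSpace S] {μ : Measure S} [IsProbabilityMeasure μ]
    (hg : Measurable g) (hb : ∀ x, |g x| ≤ b) : l2NormSq μ g ≤ b ^ 2 := by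
  calc l2NormSq μ g ≤ ∫ _, b ^ 2 ∂μ :=
        integral_mono (integrable_sq_of_abs_le hg hb) (integrable_const _) fun x =>
          sq_le_sq.2 ((hb x).trans (le_abs_self b))
    _ = b ^ 2 := by simp

lemma l2NormSq_sub_le [MeasurableSpace S] {μ : Measure S} [IsProbabilityMeasure μ] {δ : ℝ}
    (hg : Measurable g) (hh : Measurable h) (hgb : ∀ x, |g x| ≤ b) (hhb : ∀ x, |h x| ≤ b)
    (hgh : ∀ x, |g x - h x| ≤ δ) : l2NormSq μ g - l2NormSq μ h ≤ 2 * b * δ := by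
  have hgi := integrable_sq_of_abs_le (μ := μ) hg hgb
  have hhi := integrable_sq_of_abs_le (μ := μ) hh hhb
  calc l2NormSq μ g - l2NormSq μ h = ∫ x, (g x ^ 2 - h x ^ 2) ∂μ := (integral_sub hgi hhi).symm
    _ ≤ ∫ _, 2 * b * δ ∂μ := integral_mono (hgi.sub hhi) (integrable_const _) fun x =>
        (abs_le.1 (abs_sq_sub_sq_le (hgb x) (hhb x) (hgh x))).2
    _ = 2 * b * δ := by simp

lemma contrast_sub_le {κ : ℝ} (hκ : 0 ≤ κ) (hgb : ∀ x, |g x| ≤ b) (hhb : ∀ x, |h x| ≤ b)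
    (hgh : ∀ x, |g x - h x| ≤ b * κ) (x : Fin n → S) (w : Fin n → ℝ) :
    contrast h x w - contrast g x w ≤ κ * (3 * b ^ 2 + meanSq w) := by
  have hterm : ∀ i, (h (x i) ^ 2 - 2 * w i * h (x i)) - (g (x i) ^ 2 - 2 * w i * g (x i))
      ≤ κ * (3 * b ^ 2 + w i ^ 2) := fun i => by
    have hsq := (abs_le.1 (abs_sq_sub_sq_le (hgb (x i)) (hhb (x i)) (hgh (x i)))).1
    have hcross : 2 * w i * (g (x i) - h (x i)) ≤ κ * (b ^ 2 + w i ^ 2) := calc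
      2 * w i * (g (x i) - h (x i)) ≤ |2 * w i * (g (x i) - h (x i))| := le_abs_self _
      _ = 2 * |w i| * |g (x i) - h (x i)| := by rw [abs_mul, abs_mul, abs_two]
      _ ≤ 2 * |w i| * (b * κ) := by gcongr; exact hgh _
      _ = κ * (2 * b * |w i|) := by ring
      _ ≤ κ * (b ^ 2 + |w i| ^ 2) := by gcongr; exact two_mul_le_add_sq _ _
      _ = κ * (b ^ 2 + w i ^ 2) := by rw [sq_abs]
    linarith
  have hmean : (1 / (n : ℝ)) * (n * (3 * b ^ 2)) ≤ 3 * b ^ 2 := by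
    rw [← mul_assoc]
    exact mul_le_of_le_one_left (by positivity) (by rw [one_div]; exact inv_mul_le_one)
  calc contrast h x w - contrast g x w
      ≤ (1 / (n : ℝ)) * ∑ i, κ * (3 * b ^ 2 + w i ^ 2) := by
        rw [contrast, contrast, ← mul_sub, ← Finset.sum_sub_distrib]
        gcongr with i
        exact hterm i
    _ = κ * ((1 / (n : ℝ)) * (n * (3 * b ^ 2)) + meanSq w) := by
        rw [← Finset.mul_sum, Finset.sum_add_distrib, meanSq, Finset.sum_const, Finset.card_univ,
          Fintype.card_fin, nsmul_eq_mul]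
        ring
    _ ≤ κ * (3 * b ^ 2 + meanSq w) := by gcongr

lemma deviation_le_of_abs_sub_le [MeasurableSpace S] {μ : Measure S} [IsProbabilityMeasure μ]
    {κ ε : ℝ} (hκ : 0 ≤ κ) (hε : 0 ≤ ε) (hε₁ : ε ≤ 1) (hg : Measurable g) (hh : Measurable h)
    (hgb : ∀ x, |g x| ≤ b) (hhb : ∀ x, |h x| ≤ b) (hgh : ∀ x, |g x - h x| ≤ b * κ)
    (x : Fin n → S) (w : Fin n → ℝ) :
    deviation μ ε g x w ≤ deviation μ ε h x w + κ * (8 * b ^ 2 + 2 * meanSq w) := by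
  have hnorm := l2NormSq_sub_le (μ := μ) hg hh hgb hhb hgh
  have hcontrast : (1 + ε) * (contrast h x w - contrast g x w)
      ≤ 2 * (κ * (3 * b ^ 2 + meanSq w)) := by
    have := meanSq_nonneg w
    refine (mul_le_mul_of_nonneg_left (contrast_sub_le hκ hgb hhb hgh x w) (by linarith)).trans ?_
    gcongr
    linarith
  simp only [deviation]
  linarith

end Stability

section BasicInequality

/-- The total amount by which the deviations of the points of the `ℓ¹`-grid exceed half of their
penalty. -/
def gridExcess {S : Type*} [MeasurableSpace S] {n M : ℕ} (μ : Measure S) (ε K₁ T : ℝ) (f : S → ℝ)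
    (fs : Fin M → S → ℝ) (x : Fin n → S) (w : Fin n → ℝ) : ℝ :=
  ∑ a ∈ intL1Ball (Fin M) n,
    max (deviation μ ε (fun z => linComb fs (gridPoint T n a) z - f z) x w
      - K₁ / (2 * n) * complexity (max (M : ℝ) n) (hammingNorm a)) 0

lemma rounding_cost_le {b v K₁ m : ℝ} {n k : ℕ} (hv : 0 ≤ v) (hK : 24 * (v + b ^ 2) ≤ K₁)
    (hk : (k : ℝ) ≤ m) (V : ℝ) :
    min ((k : ℝ) / n) 1 * (8 * b ^ 2 + 2 * V)
      ≤ K₁ / (2 * n) * complexity m k + 2 * max (V - 2 * v) 0 := by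
  set κ : ℝ := min ((k : ℝ) / n) 1
  have hκ : 0 ≤ κ := by positivity
  have hlog : (2 / 3 : ℝ) ≤ Real.log 2 := by linarith [Real.log_two_gt_d9]
  have hmodel : κ * (8 * (v + b ^ 2)) ≤ K₁ / (2 * n) * complexity m k := calc
    κ * (8 * (v + b ^ 2)) ≤ k / n * (K₁ / 3) := by
      gcongr
      · exact min_le_left _ _
      · linarith
    _ = K₁ / (2 * n) * (k * (2 / 3)) := by ring
    _ ≤ K₁ / (2 * n) * complexity m k := by
      have : 0 ≤ K₁ := (by positivity : 0 ≤ 24 * (v + b ^ 2)).trans hK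
      gcongr
      exact (by gcongr : (k : ℝ) * (2 / 3) ≤ k * Real.log 2).trans (mul_log_two_le_complexity hk)
  have hnoise : κ * (V - 2 * v) ≤ max (V - 2 * v) 0 := calc
    κ * (V - 2 * v) ≤ κ * max (V - 2 * v) 0 := by gcongr; exact le_max_left _ _
    _ ≤ max (V - 2 * v) 0 := mul_le_of_le_one_left (le_max_right _ _) (min_le_right _ _)
  nlinarith [mul_nonneg hκ hv]

variable {S : Type*} [MeasurableSpace S] {μ : Measure S} {n M : ℕ} {f : S → ℝ}
  {fs : Fin M → S → ℝ} {L T ε v K₁ : ℝ} {lam : Fin M → ℝ}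

lemma deviation_gridPoint_le (ε K₁ T : ℝ) {a : Fin M → ℤ} (ha : a ∈ intL1Ball (Fin M) n)
    (x : Fin n → S) (w : Fin n → ℝ) :
    deviation μ ε (fun z => linComb fs (gridPoint T n a) z - f z) x w
      ≤ K₁ / (2 * n) * complexity (max (M : ℝ) n) (hammingNorm a)
        + gridExcess μ ε K₁ T f fs x w := by
  rw [← sub_le_iff_le_add']
  exact (le_max_left _ 0).trans <| Finset.single_le_sum (f := fun a : Fin M → ℤ =>
    max (deviation μ ε (fun z => linComb fs (gridPoint T n a) z - f z) x w
      - K₁ / (2 * n) * complexity (max (M : ℝ) n) (hammingNorm a)) 0)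
    (fun _ _ => le_max_right _ _) ha

lemma deviation_le_penalty_add_gridExcess [IsProbabilityMeasure μ] (hn : 1 ≤ n) (hf : Measurable f)
    (hfs : ∀ j, Measurable (fs j)) (hfL : ∀ x, |f x| ≤ L) (hfsL : ∀ j x, |fs j x| ≤ L)
    (hT : 0 < T) (hε : 0 ≤ ε) (hε₁ : ε ≤ 1) (hv : 0 ≤ v)
    (hK : 24 * (v + (L * (T + 1)) ^ 2) ≤ K₁) (hlam : lam ∈ l1Ball M T) (x : Fin n → S)
    (w : Fin n → ℝ) :
    deviation μ ε (fun z => linComb fs lam z - f z) x w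
      ≤ penalty K₁ n lam + gridExcess μ ε K₁ T f fs x w + 2 * max (meanSq w - 2 * v) 0 := by
  have hL : 0 ≤ L := (abs_nonneg _).trans (hfL (x ⟨0, hn⟩))
  have hK₀ : 0 ≤ K₁ := (by positivity : 0 ≤ 24 * (v + (L * (T + 1)) ^ 2)).trans hK
  have hmeas := measurable_linComb_sub hf hfs
  have hbound : ∀ lam' ∈ l1Ball M T, ∀ z, |linComb fs lam' z - f z| ≤ L * (T + 1) :=
    fun lam' hlam' z => abs_linComb_sub_le (hfL z) (hfsL · z) hlam'
  obtain ⟨a, ha, hsupport, hround⟩ := exists_sum_abs_sub_gridPoint_le hn hT hlam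
  set κ : ℝ := min ((numNonzero lam : ℝ) / n) 1
  have hclose : ∀ z, |(linComb fs lam z - f z) - (linComb fs (gridPoint T n a) z - f z)|
      ≤ L * (T + 1) * κ := fun z => calc
    _ = |linComb fs (lam - gridPoint T n a) z| := by
      rw [sub_sub_sub_cancel_right, linComb_sub_linComb]
    _ ≤ T * κ * L := (abs_linComb_le (hfsL · z) _).trans (by gcongr; exact hround)
    _ ≤ L * (T + 1) * κ := by nlinarith [mul_nonneg hL (by positivity : 0 ≤ κ)]
  have hdeviation := deviation_le_of_abs_sub_le (μ := μ) (by positivity) hε hε₁ (hmeas lam)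
    (hmeas _) (hbound lam hlam) (hbound _ (gridPoint_mem_l1Ball hn hT.le ha)) hclose x w
  have hgrid := deviation_gridPoint_le (μ := μ) (f := f) (fs := fs) ε K₁ T ha x w
  have hmono : K₁ / (2 * n) * complexity (max (M : ℝ) n) (hammingNorm a)
      ≤ K₁ / (2 * n) * complexity (max (M : ℝ) n) (numNonzero lam) := by
    gcongr
    exact complexity_mono (by positivity) hsupport
  have hcost := rounding_cost_le (n := n) (k := numNonzero lam) hv hK
    (le_max_of_le_left (b := (M : ℝ)) (c := n)
      (by exact_mod_cast (Finset.card_filter_le _ _).trans_eq (Finset.card_fin M))) (meanSq w)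
  have hhalf : penalty K₁ n lam
      = 2 * (K₁ / (2 * n) * complexity (max (M : ℝ) n) (numNonzero lam)) := by
    rw [penalty_eq]
    ring
  linarith

lemma penalty_nonneg (hK : 0 ≤ K₁) (n : ℕ) (lam : Fin M → ℝ) : 0 ≤ penalty K₁ n lam := by
  rw [penalty_eq]
  have := complexity_nonneg (m := max (M : ℝ) n) (by positivity) (numNonzero lam)
  positivity

lemma IsPenalizedLSE.l2NormSq_le [IsProbabilityMeasure μ] {x : Fin n → S} {w : Fin n → ℝ}
    (hlam : IsPenalizedLSE K₁ T fs x (fun i => f (x i) + w i) lam) (hn : 1 ≤ n)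
    (hf : Measurable f) (hfs : ∀ j, Measurable (fs j)) (hfL : ∀ x, |f x| ≤ L)
    (hfsL : ∀ j x, |fs j x| ≤ L) (hT : 0 < T) (hε : 0 ≤ ε) (hε₁ : ε ≤ 1) (hv : 0 ≤ v)
    (hK : 24 * (v + (L * (T + 1)) ^ 2) ≤ K₁) {lam' : Fin M → ℝ} (hlam' : lam' ∈ l1Ball M T) :
    l2NormSq μ (fun z => linComb fs lam z - f z)
      ≤ (1 + ε) * (contrast (fun z => linComb fs lam' z - f z) x w + penalty K₁ n lam')
        + gridExcess μ ε K₁ T f fs x w + 2 * max (meanSq w - 2 * v) 0 := by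
  have hdeviation := deviation_le_penalty_add_gridExcess (μ := μ) hn hf hfs hfL hfsL hT hε hε₁ hv
    hK hlam.1 x w
  have hmin := hlam.2 lam' hlam'
  rw [residual_eq, residual_eq] at hmin
  have hpenalty := penalty_nonneg ((by positivity : 0 ≤ 24 * (v + (L * (T + 1)) ^ 2)).trans hK)
    n lam
  rw [deviation] at hdeviation
  nlinarith

end BasicInequality

section OracleInequality

variable {Ω S : Type*} [MeasurableSpace Ω] [MeasurableSpace S] {μ : Measure S} {M : ℕ}
  {f : S → ℝ} {fs : Fin M → S → ℝ}

lemma measurable_l2NormSq_linComb_sub [SFinite μ] (hf : Measurable f)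
    (hfs : ∀ j, Measurable (fs j)) {lamHat : Ω → Fin M → ℝ} (hlamHat : Measurable lamHat) :
    Measurable fun ω => l2NormSq μ fun x => linComb fs (lamHat ω) x - f x := by
  have hloss : Measurable fun p : Ω × S => (linComb fs (lamHat p.1) p.2 - f p.2) ^ 2 :=
    (((measurable_linComb hfs).comp (hlamHat.prodMap measurable_id)).sub
      (hf.comp measurable_snd)).pow_const 2
  exact hloss.stronglyMeasurable.integral_prod_right'.measurable

variable [IsProbabilityMeasure μ]

lemma integrable_l2NormSq_linComb_sub {P : Measure Ω} [IsFiniteMeasure P] (hf : Measurable f)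
    (hfs : ∀ j, Measurable (fs j)) {L T : ℝ} (hfL : ∀ x, |f x| ≤ L) (hfsL : ∀ j x, |fs j x| ≤ L)
    {lamHat : Ω → Fin M → ℝ} (hlamHat : Measurable lamHat) (hball : ∀ ω, lamHat ω ∈ l1Ball M T) :
    Integrable (fun ω => l2NormSq μ fun x => linComb fs (lamHat ω) x - f x) P :=
  .of_bound (measurable_l2NormSq_linComb_sub hf hfs hlamHat).aestronglyMeasurable
    ((L * (T + 1)) ^ 2) <| ae_of_all _ fun ω => by
      rw [Real.norm_of_nonneg (l2NormSq_nonneg _ _)]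
      exact l2NormSq_le (measurable_linComb_sub hf hfs _) fun x =>
        abs_linComb_sub_le (hfL x) (hfsL · x) (hball ω)

namespace IsGaussianRandomDesign

variable {P : Measure Ω} [IsProbabilityMeasure P] {n : ℕ} {σ L T ε K₁ : ℝ} {X : Fin n → Ω → S}
  {W : Fin n → Ω → ℝ}

lemma integral_gridExcess_le [NeZero M] (h : IsGaussianRandomDesign P μ σ X W) (hn : 1 ≤ n)
    (hf : Measurable f) (hfs : ∀ j, Measurable (fs j)) (hfL : ∀ x, |f x| ≤ L)
    (hfsL : ∀ j x, |fs j x| ≤ L) (hT : 0 ≤ T) (hε₁ : ε ≤ 1) {t : ℝ} (ht : 0 < t)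
    (hts : t * (16 * (σ ^ 2 + (L * (T + 1)) ^ 2)) ≤ ε) (hK : 14 ≤ t * K₁) :
    Integrable (fun ω => gridExcess μ ε K₁ T f fs (fun i => X i ω) (fun i => W i ω)) P ∧
      ∫ ω, gridExcess μ ε K₁ T f fs (fun i => X i ω) (fun i => W i ω) ∂P ≤ 2 / (n * t) := by
  have : (0 : ℝ) < n := by exact_mod_cast hn
  have hexcess := fun a (ha : a ∈ intL1Ball (Fin M) n) =>
    h.integral_deviation_excess_le hn (measurable_linComb_sub hf hfs (gridPoint T n a))
      (fun x => abs_linComb_sub_le (hfL x) (hfsL · x) (gridPoint_mem_l1Ball hn hT ha)) hε₁ ht hts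
      (K₁ / (2 * n) * complexity (max (M : ℝ) n) (hammingNorm a))
  have hexponent : ∀ a : Fin M → ℤ, 7 * complexity (max (M : ℝ) n) (hammingNorm a)
      ≤ n * t * (K₁ / (2 * n) * complexity (max (M : ℝ) n) (hammingNorm a)) := fun a => by
    have := complexity_nonneg (m := max (M : ℝ) n) (by positivity) (hammingNorm a)
    calc 7 * complexity (max (M : ℝ) n) (hammingNorm a)
        ≤ t * K₁ / 2 * complexity (max (M : ℝ) n) (hammingNorm a) := by gcongr; linarith
      _ = n * t * (K₁ / (2 * n) * complexity (max (M : ℝ) n) (hammingNorm a)) := by field_simp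
  simp only [gridExcess]
  refine ⟨integrable_finsetSum _ fun a ha => (hexcess a ha).1, ?_⟩
  rw [integral_finsetSum _ fun a ha => (hexcess a ha).1]
  calc _ ≤ ∑ a ∈ intL1Ball (Fin M) n,
        Real.exp (-(7 * complexity (max (M : ℝ) n) (hammingNorm a))) / (n * t) := by
        refine Finset.sum_le_sum fun a ha => (hexcess a ha).2.trans ?_
        exact div_le_div_of_nonneg_right
          (Real.exp_le_exp.2 (neg_le_neg (hexponent a))) (by positivity)
    _ ≤ 2 / (n * t) := by
        rw [← Finset.sum_div]
        gcongr
        exact sum_exp_neg_complexity_le_two hn (le_max_right _ _) (by simp)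

lemma integral_l2NormSq_linComb_sub_le_of_mul_le [NeZero M]
    (h : IsGaussianRandomDesign P μ σ X W) (hn : 1 ≤ n) (hf : Measurable f)
    (hfs : ∀ j, Measurable (fs j)) (hfL : ∀ x, |f x| ≤ L) (hfsL : ∀ j x, |fs j x| ≤ L)
    (hσ : 0 < σ) (hT : 0 < T) (hε₁ : ε ≤ 1) {t : ℝ} (ht : 0 < t)
    (hts : t * (16 * (σ ^ 2 + (L * (T + 1)) ^ 2)) ≤ ε) (hK : 14 ≤ t * K₁)
    {lamHat : Ω → Fin M → ℝ} (hlamHat : Measurable lamHat)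
    (hmin : ∀ ω, IsPenalizedLSE K₁ T fs (fun i => X i ω) (fun i => f (X i ω) + W i ω) (lamHat ω))
    {lam : Fin M → ℝ} (hlam : lam ∈ l1Ball M T) :
    ∫ ω, l2NormSq μ (fun x => linComb fs (lamHat ω) x - f x) ∂P
      ≤ (1 + ε) * (l2NormSq μ (fun x => linComb fs lam x - f x) + penalty K₁ n lam)
        + 2 / (n * t) + 8 * σ ^ 2 / n := by
  have hε : 0 ≤ ε := le_trans (by positivity) hts
  have hKσ : 24 * (σ ^ 2 + (L * (T + 1)) ^ 2) ≤ K₁ := le_of_mul_le_mul_left (by linarith) ht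
  set C : Ω → ℝ := fun ω =>
    contrast (fun x => linComb fs lam x - f x) (fun i => X i ω) (fun i => W i ω)
  set G : Ω → ℝ := fun ω => gridExcess μ ε K₁ T f fs (fun i => X i ω) (fun i => W i ω)
  set V : Ω → ℝ := fun ω => max (meanSq (fun i => W i ω) - 2 * σ ^ 2) 0
  obtain ⟨hC, hC_eq⟩ : Integrable C P ∧ ∫ ω, C ω ∂P = _ :=
    h.integral_contrast hn (measurable_linComb_sub hf hfs lam) fun x =>
      abs_linComb_sub_le (hfL x) (hfsL · x) hlam
  obtain ⟨hG, hG_le⟩ : Integrable G P ∧ ∫ ω, G ω ∂P ≤ 2 / (n * t) :=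
    h.integral_gridExcess_le hn hf hfs hfL hfsL hT.le hε₁ ht hts hK
  obtain ⟨hV, hV_le⟩ : Integrable V P ∧ ∫ ω, V ω ∂P ≤ 4 * σ ^ 2 / n :=
    h.integral_meanSq_excess_le hn hσ
  have hCpen : Integrable (fun ω => (1 + ε) * (C ω + penalty K₁ n lam)) P :=
    (hC.add (integrable_const _)).const_mul _
  have hCG : Integrable (fun ω => (1 + ε) * (C ω + penalty K₁ n lam) + G ω) P := hCpen.add hG
  calc _ ≤ ∫ ω, ((1 + ε) * (C ω + penalty K₁ n lam) + G ω + 2 * V ω) ∂P :=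
        integral_mono (integrable_l2NormSq_linComb_sub hf hfs hfL hfsL hlamHat fun ω => (hmin ω).1)
          (hCG.add (hV.const_mul 2)) fun ω =>
            (hmin ω).l2NormSq_le hn hf hfs hfL hfsL hT hε hε₁ (sq_nonneg σ) hKσ hlam
    _ = (1 + ε) * ((∫ ω, C ω ∂P) + penalty K₁ n lam) + ∫ ω, G ω ∂P + 2 * ∫ ω, V ω ∂P := by
        rw [integral_add hCG (hV.const_mul 2), integral_add hCpen hG, integral_const_mul,
          integral_const_mul, integral_add hC (integrable_const _)]
        simp
    _ ≤ (1 + ε) * ((∫ ω, C ω ∂P) + penalty K₁ n lam) + 2 / (n * t) + 2 * (4 * σ ^ 2 / n) := by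
        gcongr
    _ = _ := by rw [hC_eq]; ring

theorem integral_l2NormSq_linComb_sub_le [NeZero M] (h : IsGaussianRandomDesign P μ σ X W)
    (hn : 1 ≤ n) (hf : Measurable f) (hfs : ∀ j, Measurable (fs j)) (hfL : ∀ x, |f x| ≤ L)
    (hfsL : ∀ j x, |fs j x| ≤ L) (hσ : 0 < σ) (hT : 0 < T) (hε : 0 < ε) (hε₁ : ε ≤ 1)
    (hK : 224 * (σ ^ 2 + (L * (T + 1)) ^ 2) / ε ≤ K₁) {lamHat : Ω → Fin M → ℝ}
    (hlamHat : Measurable lamHat)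
    (hmin : ∀ ω, IsPenalizedLSE K₁ T fs (fun i => X i ω) (fun i => f (X i ω) + W i ω) (lamHat ω))
    {lam : Fin M → ℝ} (hlam : lam ∈ l1Ball M T) :
    ∫ ω, l2NormSq μ (fun x => linComb fs (lamHat ω) x - f x) ∂P
      ≤ (1 + ε) * (l2NormSq μ (fun x => linComb fs lam x - f x) + penalty K₁ n lam)
        + (32 * (σ ^ 2 + (L * (T + 1)) ^ 2) / ε + 8 * σ ^ 2) / n := by
  set Q : ℝ := σ ^ 2 + (L * (T + 1)) ^ 2
  have hQ : 0 < Q := by positivity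
  have htK : 14 ≤ ε / (16 * Q) * K₁ := calc
    14 = ε / (16 * Q) * (224 * Q / ε) := by field_simp; norm_num
    _ ≤ ε / (16 * Q) * K₁ := by gcongr
  refine (h.integral_l2NormSq_linComb_sub_le_of_mul_le hn hf hfs hfL hfsL hσ hT hε₁
    (by positivity) (div_mul_cancel₀ ε (by positivity)).le htK hlamHat hmin hlam).trans_eq ?_
  field_simp
  ring

end IsGaussianRandomDesign

end OracleInequality

section ModelSelection

/-- The threshold `K^*(ε, B, v)` for the constant of the penalty, at noise variance `v`. The oracle
inequality is applied with `ε ∧ 1` in place of `ε`. -/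
def penaltyThreshold (ε B v : ℝ) : ℝ := 224 * (v + B) / min ε 1

lemma penaltyThreshold_pos {ε B v : ℝ} (hε : 0 < ε) (hB : 0 ≤ B) (hv : 0 < v) :
    0 < penaltyThreshold ε B v :=
  div_pos (by positivity) (lt_min hε one_pos)

lemma one_div_min_one_le {ε : ℝ} (hε : 0 < ε) : 1 / min ε 1 ≤ 1 + 1 / ε := by
  have : 0 < 1 / ε := by positivity
  rcases min_choice ε 1 with h | h <;> rw [h] <;> linarith

lemma log_one_add_le_two_mul_log {m : ℝ} (hm : 2 ≤ m) : Real.log (1 + m) ≤ 2 * Real.log m := by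
  have : Real.log (1 + m) ≤ Real.log (m ^ 2) := Real.log_le_log (by linarith) (by nlinarith)
  rwa [Real.log_pow] at this

lemma remainder_le {ε B v K₁ R m : ℝ} (hε : 0 < ε) (hB : 0 ≤ B) (hv : 0 < v)
    (hK : penaltyThreshold ε B v ≤ K₁) (hKR : K₁ ≤ R * penaltyThreshold ε B v) (hm : 2 ≤ m) :
    (1 + min ε 1) * (K₁ * Real.log (1 + m)) + 32 * (v + B) / min ε 1 + 8 * v
      ≤ 1000 * R * ((v + B) * (1 + 1 / ε)) * Real.log m := by
  have hthreshold := penaltyThreshold_pos hε hB hv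
  have hR : 1 ≤ R := le_of_mul_le_mul_right (by linarith) hthreshold
  have hK₀ : 0 ≤ K₁ := hthreshold.le.trans hK
  set D : ℝ := (v + B) * (1 + 1 / ε)
  have hD : (v + B) / min ε 1 ≤ D := by
    rw [div_eq_mul_one_div]
    exact mul_le_mul_of_nonneg_left (one_div_min_one_le hε) (by positivity)
  have hvD : v ≤ D := (le_add_of_nonneg_right hB).trans
    (le_mul_of_one_le_right (by positivity) (by simpa using hε.le))
  have hlog : 1 / 2 ≤ Real.log m := by
    linarith [Real.log_two_gt_d9, Real.log_le_log two_pos hm]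
  have hlog₀ : 0 ≤ Real.log (1 + m) := Real.log_nonneg (by linarith)
  have hpenalty : (1 + min ε 1) * (K₁ * Real.log (1 + m))
      ≤ (1 + 1) * (R * (224 * D) * (2 * Real.log m)) := by
    gcongr
    · exact min_le_right _ _
    · calc K₁ ≤ R * (224 * ((v + B) / min ε 1)) := by
            rwa [penaltyThreshold, mul_div_assoc] at hKR
        _ ≤ R * (224 * D) := by gcongr
    · exact log_one_add_le_two_mul_log hm
  have hconst : D ≤ 2 * (R * D * Real.log m) := calc
    D = 2 * (1 * D * (1 / 2)) := by ring
    _ ≤ 2 * (R * D * Real.log m) := by have := hv.le.trans hvD; gcongr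
  rw [mul_div_assoc]
  linarith

lemma penalty_single {M : ℕ} (K₁ : ℝ) (n : ℕ) (j : Fin M) :
    penalty K₁ n (Pi.single j 1 : Fin M → ℝ) = K₁ / n * Real.log (1 + max (M : ℝ) n) := by
  rw [penalty_eq, numNonzero_single, complexity_of_pos _ le_rfl, Nat.cast_one, div_one, one_mul]

end ModelSelection

end Aggregation

end

open Aggregation in
theorem corollary3p7_general {Ω S : Type*} [MeasurableSpace Ω] [MeasurableSpace S]
    {P : Measure Ω} [IsProbabilityMeasure P] {μ : Measure S} [IsProbabilityMeasure μ] {n M : ℕ}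
    {σ L T ε K₁ R : ℝ} {f : S → ℝ} {fs : Fin M → S → ℝ} {X : Fin n → Ω → S} {W : Fin n → Ω → ℝ}
    {lamHat : Ω → Fin M → ℝ} (hσ : 0 < σ) (hT : 1 ≤ T) (hε : 0 < ε)
    (hK : penaltyThreshold ε (L ^ 2 * (T + 1) ^ 2) (σ ^ 2) ≤ K₁)
    (hKR : K₁ ≤ R * penaltyThreshold ε (L ^ 2 * (T + 1) ^ 2) (σ ^ 2)) (hn : 1 ≤ n) (hM : 2 ≤ M)
    (hf : Measurable f) (hfs : ∀ j, Measurable (fs j)) (hfL : ∀ x, |f x| ≤ L)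
    (hfsL : ∀ j x, |fs j x| ≤ L) (h : IsGaussianRandomDesign P μ σ X W)
    (hlamHat : Measurable lamHat)
    (hmin : ∀ ω, IsPenalizedLSE K₁ T fs (fun i => X i ω) (fun i => f (X i ω) + W i ω)
      (lamHat ω)) :
    Integrable (fun ω => l2NormSq μ fun x => linComb fs (lamHat ω) x - f x) P ∧
      ∫ ω, l2NormSq μ (fun x => linComb fs (lamHat ω) x - f x) ∂P
        ≤ (1 + ε) * (⨅ j : Fin M, l2NormSq μ fun x => fs j x - f x)
          + 1000 * R * (1 + L ^ 2 * (T + 1) ^ 2 / σ ^ 2) * σ ^ 2 * (1 + 1 / ε)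
            * (Real.log (max (M : ℝ) n) / n) := by
  refine ⟨integrable_l2NormSq_linComb_sub hf hfs hfL hfsL hlamHat fun ω => (hmin ω).1, ?_⟩
  have : NeZero M := ⟨by lia⟩
  obtain ⟨j, hj⟩ :=
    exists_eq_ciInf_of_finite (f := fun j : Fin M => l2NormSq μ fun x => fs j x - f x)
  have horacle := h.integral_l2NormSq_linComb_sub_le hn hf hfs hfL hfsL hσ (by linarith)
    (lt_min hε one_pos) (min_le_right ε 1) (by rwa [mul_pow]) hlamHat hmin (single_mem_l1Ball hT j)
  rw [linComb_single, penalty_single, mul_pow] at horacle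
  have hremainder := remainder_le hε (by positivity) (by positivity) hK hKR
    ((by exact_mod_cast hM : (2 : ℝ) ≤ M).trans (le_max_left (M : ℝ) n))
  have hnonneg := l2NormSq_nonneg μ fun x => fs j x - f x
  rw [← hj]
  set B : ℝ := L ^ 2 * (T + 1) ^ 2
  calc _ ≤ (1 + min ε 1) * l2NormSq μ (fun x => fs j x - f x)
          + ((1 + min ε 1) * (K₁ * Real.log (1 + max (M : ℝ) n))
            + 32 * (σ ^ 2 + B) / min ε 1 + 8 * σ ^ 2) / n := horacle.trans_eq (by ring)
    _ ≤ (1 + ε) * l2NormSq μ (fun x => fs j x - f x)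
          + 1000 * R * ((σ ^ 2 + B) * (1 + 1 / ε)) * Real.log (max (M : ℝ) n) / n := by
        gcongr
        exact min_le_left _ _
    _ = _ := by field_simp

theorem corollary3p7 :
    ∃ Kstar : ℝ → ℝ → ℝ → ℝ,
      (∀ ε B v : ℝ, 0 < ε → 0 ≤ B → 0 < v → 0 < Kstar ε B v) ∧
      ∀ R : ℝ, 1 ≤ R → ∃ c : ℝ, 0 < c ∧
        ∀ (σ L T B : ℝ), 0 < σ → 1 ≤ T → B = L ^ 2 * (T + 1) ^ 2 →
        ∀ (ε : ℝ), 0 < ε →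
        ∀ (K₁ : ℝ), Kstar ε B (σ ^ 2) ≤ K₁ → K₁ ≤ R * Kstar ε B (σ ^ 2) →
        ∀ (n M : ℕ), 1 ≤ n → 2 ≤ M →
        ∀ (d : ℕ) (𝒳 : Set (EuclideanSpace ℝ (Fin d))), MeasurableSet 𝒳 →
        ∀ (μ : Measure 𝒳) [IsProbabilityMeasure μ]
          (f : 𝒳 → ℝ) (fs : Fin M → 𝒳 → ℝ),
          Measurable f → (∀ j, Measurable (fs j)) →
          (∀ x, |f x| ≤ L) → (∀ j x, |fs j x| ≤ L) →
        ∀ (Ω : Type*) [MeasurableSpace Ω] (P : Measure Ω) [IsProbabilityMeasure P]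
          (X : Fin n → Ω → 𝒳) (W : Fin n → Ω → ℝ),
          Aggregation.IsGaussianRandomDesign P μ σ X W →
        ∀ (lamHat : Ω → Fin M → ℝ), Measurable lamHat →
          (∀ ω, Aggregation.IsPenalizedLSE K₁ T fs (fun i => X i ω)
            (fun i => f (X i ω) + W i ω) (lamHat ω)) →
          Integrable (fun ω => Aggregation.l2NormSq μ
            (fun x => Aggregation.linComb fs (lamHat ω) x - f x)) P ∧
          ∫ ω, Aggregation.l2NormSq μ
              (fun x => Aggregation.linComb fs (lamHat ω) x - f x) ∂P ≤
            (1 + ε) * (⨅ j : Fin M, Aggregation.l2NormSq μ (fun x => fs j x - f x)) +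
              (c * (1 + B / σ ^ 2)) * σ ^ 2 * (1 + 1 / ε) *
                (Real.log (max (M : ℝ) (n : ℝ)) / (n : ℝ)) := by
  refine ⟨Aggregation.penaltyThreshold, fun ε B v => Aggregation.penaltyThreshold_pos,
    fun R hR => ⟨1000 * R, by positivity, ?_⟩⟩
  rintro σ L T _ hσ hT rfl ε hε K₁ hK hKR n M hn hM d 𝒳 - μ _ f fs hf hfs hfL hfsL Ω _ P _ X W h
    lamHat hlamHat hmin
  exact corollary3p7_general hσ hT hε hK hKR hn hM hf hfs hfL hfsL h hlamHat hmin
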